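/- Let $X$ be an infinite-dimensional separable unital $C^*$-algebra with dual space $X^*$ (continuous complex-linear functionals with the usual norm). Let $\mathbf F(X^*)$ be the set of all nonempty weak$^*$-closed subsets of $X^*$, endowed with the weak$^*$-Hausdorff hypertopology, i.e. the topology induced by the family of pseudometrics, with values in $[0,\infty]$, $$d_H^{(A)}(F,G)=\max\Big\{\sup_{\sigma\in F}\inf_{\tau\in G}|(\sigma-\tau)(A)|,\ \sup_{\tau\in G}\inf_{\sigma\in F}|(\sigma-\tau)(A)|\Big\},\qquad A\in X .$$ All subsets of $\mathbf F(X^*)$ carry the subspace topology. Let $\mathbf{CF}(X^*)\subseteq\mathbf F(X^*)$ be the set of convex members, and let $X^{*,+}=\{\sigma\in X^*:\sigma(AA^*)\ge 0\text{ for all }A\in X\}$ be the set of positive functionals. Let $\mathbf{CK}(X^{*,+})$ be the set of all nonempty convex weak$^*$-compact subsets $K$ of $X^{*,+}$; let $\mathbf{CK}_{\le 1}(X^{*,+})$, respectively $\mathbf{CK}_{1}(X^{*,+})$, be the set of those $K\in \mathbf{CK}(X^{*,+})$ with $\|\sigma\|\le 1$, respectively $\|\sigma\|=1$, for all $\sigma\in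 K$. Let $\mathcal D^+$ be the set of all $K\in\mathbf{CK}(X^{*,+})$ that are the weak$^*$-closure of their set of extreme points. Then: (i) $\mathbf{CK}(X^{*,+})$ is a closed subset of $\mathbf{CF}(X^*)$, and $\mathcal D^+$ is a dense $G_\delta$ subset of $\mathbf{CK}(X^{*,+})$. (ii) $\mathbf{CK}_{\le 1}(X^{*,+})$ is compact and completely metrizable, and $\mathcal D^+\cap\mathbf{CK}_{\le 1}(X^{*,+})$ is a dense $G_\delta$ subset of it. (iii) The state space $E_X=\{\sigma\in X^{*,+}:\|\sigma\|=1\}$ belongs to $\mathbf{CK}_1(X^{*,+})$; the space $\mathbf{CK}_{1}(X^{*,+})$ is compact and completely metrizable, and $\mathcal D^+\cap\mathbf{CK}_{1}(X^{*,+})$ is a dense $G_\delta$ subset of it. -/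

import Mathlib

open Set Topology

/-- The set `F(X*)` of nonempty weak-star closed subsets of the dual `X*` of a complex normed
space `X`. `WeakDual ℂ X` is the space of continuous linear functionals on `X` with its
weak-star topology. -/
@[ext]
structure Hyperspace (X : Type*) [NormedAddCommGroup X] [NormedSpace ℂ X] where
  carrier : Set (WeakDual ℂ X)
  nonempty : carrier.Nonempty
  isClosed : IsClosed carrier

namespace Hyperspace

section Topology

variable {X : Type*} [NormedAddCommGroup X] [NormedSpace ℂ X]

/-- The Hausdorff pseudometric `d_H^(A)`, with values in `[0, ∞]`. -/
noncomputable def dist (A : X) (F G : Hyperspace X) : ENNReal :=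
  max (⨆ σ ∈ F.carrier, ⨅ τ ∈ G.carrier, ‖(σ - τ) A‖ₑ)
    (⨆ τ ∈ G.carrier, ⨅ σ ∈ F.carrier, ‖(σ - τ) A‖ₑ)

/-- `d_H^(A)(F, G)` is the Hausdorff distance between the sets of values of `F` and `G` at `A`. -/
theorem dist_eq (A : X) (F G : Hyperspace X) :
    dist A F G = Metric.hausdorffEDist
      ((fun σ : WeakDual ℂ X => σ A) '' F.carrier) ((fun σ : WeakDual ℂ X => σ A) '' G.carrier) := by
  have h : ∀ σ τ : WeakDual ℂ X, ‖(σ - τ) A‖ₑ = edist (σ A) (τ A) := fun σ τ => by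
    rw [edist_eq_enorm_sub]; rfl
  simp only [dist, h, Metric.hausdorffEDist, Metric.infEDist, iSup_image, iInf_image]
  simp only [edist_comm]

/-- The pseudometric `d_H^(A)` as an (extended) pseudometric structure. -/
noncomputable abbrev pseudoEMetric (A : X) : PseudoEMetricSpace (Hyperspace X) where
  edist := dist A
  edist_self F := by simp only [dist_eq, Metric.hausdorffEDist_self]
  edist_comm F G := by simp only [dist_eq]; exact Metric.hausdorffEDist_comm
  edist_triangle F G H := by simp only [dist_eq]; exact Metric.hausdorffEDist_triangle

/-- The weak-star-Hausdorff hypertopology: the topology on `F(X*)` induced by the family of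
pseudometrics `d_H^(A)`, `A ∈ X`, i.e. the coarsest topology finer than each pseudometric
topology. -/
noncomputable instance : TopologicalSpace (Hyperspace X) :=
  ⨅ A : X, (pseudoEMetric A).toUniformSpace.toTopologicalSpace

end Topology

/-- `CF(X*)`: the nonempty convex weak-star closed sets. -/
def CF (X : Type*) [NormedAddCommGroup X] [NormedSpace ℂ X] : Set (Hyperspace X) :=
  {F | Convex ℝ F.carrier}

/-- `CK(X*)`: the nonempty convex weak-star compact sets. -/
def CK (X : Type*) [NormedAddCommGroup X] [NormedSpace ℂ X] : Set (Hyperspace X) :=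
  {F | Convex ℝ F.carrier ∧ IsCompact F.carrier}

open scoped ComplexOrder in
/-- `X*⁺`: the positive continuous linear functionals on a C*-algebra `X`, i.e. those which are
real and non-negative on the cone `{A A* : A ∈ X}` of positive elements. -/
def positiveDual (X : Type*) [CStarAlgebra X] : Set (WeakDual ℂ X) :=
  {σ | ∀ A : X, 0 ≤ σ (A * star A)}

/-- `E_X`: the positive functionals of norm one (the norm is the usual dual norm). -/
noncomputable def stateSpace (X : Type*) [CStarAlgebra X] : Set (WeakDual ℂ X) :=
  {σ | σ ∈ positiveDual X ∧ ‖WeakDual.toStrongDual σ‖ = 1}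

/-- `CK(X*⁺)`. -/
def CKPos (X : Type*) [CStarAlgebra X] : Set (Hyperspace X) :=
  {K | K ∈ CK X ∧ K.carrier ⊆ positiveDual X}

/-- `CK_{≤ 1}(X*⁺)`. -/
noncomputable def CKPosLeOne (X : Type*) [CStarAlgebra X] : Set (Hyperspace X) :=
  {K | K ∈ CKPos X ∧ ∀ σ ∈ K.carrier, ‖WeakDual.toStrongDual σ‖ ≤ 1}

/-- `CK_1(X*⁺)`. -/
noncomputable def CKPosOne (X : Type*) [CStarAlgebra X] : Set (Hyperspace X) :=
  {K | K ∈ CKPos X ∧ ∀ σ ∈ K.carrier, ‖WeakDual.toStrongDual σ‖ = 1}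

/-- `D⁺`: the sets in `CK(X*⁺)` which are the weak-star closure of their extreme points. -/
def DPos (X : Type*) [CStarAlgebra X] : Set (Hyperspace X) :=
  {K | K ∈ CKPos X ∧ K.carrier = closure (K.carrier.extremePoints ℝ)}

/-- `S` is a dense `G_δ` subset of the space `T`, where `T` carries the subspace topology. -/
def IsDenseGδIn {Y : Type*} [TopologicalSpace Y] (S T : Set Y) : Prop :=
  S ⊆ T ∧ Dense ((↑) ⁻¹' S : Set T) ∧ IsGδ ((↑) ⁻¹' S : Set T)

end Hyperspace

/-! For a compact convex set `S` of functionals, `convexIn S` carries the Vietoris topology: the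
compact subsets of `S` form a compact Vietoris hyperspace, the convex ones are closed in it, and
they map continuously and bijectively onto `convexIn S`. That space is Hausdorff because, by
Hahn-Banach, the value sets at the vectors `A` determine a closed convex set (`injOn_values`). The
map is thus a homeomorphism, and separability of `X` gives metrizability.

Let `W` run through open sets tracing a countable basis of `S`. A set is the closure of its extreme
points iff, for each `W`, it misses `W` or has an extreme point in `W`. The first alternative is
closed; the second is open, by a slice argument (`isOpen_extremePoints_inter_nonempty`). Baire's
theorem reduces density to a single `W`. A set meeting `W` at `σ` is a limit of polytopes with
generator `σ`, and moving slightly from `σ` towards a state outside the span of the generators gives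
a new vertex in `W` (`polytope_mem_closure`). Such a state exists because states separate points and
`X` is infinite-dimensional (`exists_state_notMem_span`).

For a positive functional the norm is the value at `1`, so norm conditions become closed conditions
on value sets. Parts (ii) and (iii) take `S` to be the positive unit ball and the state space; part
(i) exhausts `CKPos X` by countably many closed pieces `convexIn (positiveBall X (n + 1))`. -/

/-! ### Extreme points and slices of convex sets -/

section Convexity

variable {E : Type*} [AddCommGroup E] [Module ℝ E]

/-- A point outside a convex set is an extreme point of the convex hull of their union. -/
theorem mem_extremePoints_convexHull_insert {p : E} {T : Set E} (hp : p ∉ convexHull ℝ T) :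
    p ∈ (convexHull ℝ (insert p T)).extremePoints ℝ := by
  -- A point of a convex set is extreme as soon as removing it leaves a convex set.
  rw [(convex_convexHull ℝ _).mem_extremePoints_iff_mem_sdiff_convexHull_sdiff]
  refine ⟨subset_convexHull ℝ _ (mem_insert _ _), fun h => ?_⟩
  suffices H : Convex ℝ (convexHull ℝ (insert p T) \ {p}) from
    (H.convexHull_eq ▸ h).2 rfl
  rcases T.eq_empty_or_nonempty with rfl | hT
  · simp [convex_empty]
  rw [convexHull_insert hT, convexJoin_singleton_left]
  rintro x ⟨hx, hxp⟩ y ⟨hy, hyp⟩ s t hs ht hst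
  simp only [mem_iUnion, exists_prop] at hx hy
  obtain ⟨k, hk, a, a', ha, ha', haa, rfl⟩ := hx
  obtain ⟨l, hl, b, b', hb, hb', hbb, rfl⟩ := hy
  have ha0 : 0 < a' := ha'.lt_of_ne' fun h0 => hxp (by simp [h0, show a = 1 by linarith])
  have hb0 : 0 < b' := hb'.lt_of_ne' fun h0 => hyp (by simp [h0, show b = 1 by linarith])
  have hc : 0 < s * a' + t * b' := by
    rcases hs.eq_or_lt with rfl | hs
    · have : t = 1 := by linarith
      subst this; simpa using hb0
    · have := mul_pos hs ha0
      have := mul_nonneg ht hb'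
      linarith
  -- `c` is the total weight on `convexHull ℝ T`, and `m` below is the barycentre of that share.
  set c := s * a' + t * b' with hcdef
  have hm : (s * a' / c) • k + (t * b' / c) • l ∈ convexHull ℝ T :=
    convex_convexHull ℝ T hk hl (by positivity) (by positivity)
      (by rw [← add_div, ← hcdef, div_self hc.ne'])
  set m := (s * a' / c) • k + (t * b' / c) • l with hmdef
  have hcm : c • m = (s * a') • k + (t * b') • l := by
    rw [hmdef, smul_add, smul_smul, smul_smul, mul_div_cancel₀ _ hc.ne', mul_div_cancel₀ _ hc.ne']
  have hs1 : (s * a + t * b) + c = 1 := by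
    have h1 : s * (a + a') + t * (b + b') = 1 := by rw [haa, hbb]; linarith
    rw [hcdef]; linarith
  have hz : s • (a • p + a' • k) + t • (b • p + b' • l) = (s * a + t * b) • p + c • m := by
    rw [hcm]; module
  rw [hz]
  refine ⟨mem_iUnion₂.2 ⟨m, hm, _, _, by positivity, hc.le, hs1, rfl⟩, fun h => hp ?_⟩
  -- If the combination were `p`, cancelling `c > 0` would give `p = m`, a point of `convexHull ℝ
  -- T`.
  have h1 : (s * a + t * b) • p + c • m = p := h
  have h2 : c • m = c • p := by
    have : c • p = p - (s * a + t * b) • p := by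
      rw [show c = 1 - (s * a + t * b) by linarith]; module
    rw [this, eq_sub_iff_add_eq, add_comm, h1]
  rwa [← smul_right_injective E hc.ne' h2]

theorem extremePoint_notMem_convexJoin {K s t : Set E} {p : E} (hp : p ∈ K.extremePoints ℝ)
    (hs : s ⊆ K) (ht : t ⊆ K) (hps : p ∉ s) (hpt : p ∉ t) : p ∉ convexJoin ℝ s t := by
  rw [mem_convexJoin]
  rintro ⟨a, ha, b, hb, hab⟩
  rcases (mem_extremePoints_iff_forall_segment.1 hp).2 a (hs ha) b (ht hb) hab with rfl | rfl
  exacts [hps ha, hpt hb]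

variable [TopologicalSpace E] [IsTopologicalAddGroup E] [ContinuousSMul ℝ E]

theorem isCompact_convexJoin {s t : Set E} (hs : IsCompact s) (ht : IsCompact t) :
    IsCompact (convexJoin ℝ s t) := by
  have : convexJoin ℝ s t =
      (fun q : ℝ × E × E => (1 - q.1) • q.2.1 + q.1 • q.2.2) '' (Icc 0 1 ×ˢ s ×ˢ t) := by
    ext z
    simp only [mem_convexJoin, segment_eq_image, mem_image, mem_prod, Prod.exists]
    grind
  rw [this]
  exact (isCompact_Icc.prod (hs.prod ht)).image (by fun_prop)

variable [T2Space E] [LocallyConvexSpace ℝ E]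

/-- Every neighborhood of an extreme point of a compact convex set contains a slice of the set
around that point. -/
theorem exists_slice_subset_of_mem_extremePoints {K : Set E} (hK : IsCompact K) (hKc : Convex ℝ K)
    {p : E} (hp : p ∈ K.extremePoints ℝ) {W : Set E} (hW : IsOpen W) (hpW : p ∈ W) :
    ∃ (f : StrongDual ℝ E) (c : ℝ), c < f p ∧ ∀ x ∈ K, c ≤ f x → x ∈ W := by
  -- Compactness induction on `K \ W`: locally a half-space cuts out such an `L`, and extremality of
  -- `p` keeps it outside the convex join of two of them.
  have key : ∃ L : Set E, IsCompact L ∧ Convex ℝ L ∧ L ⊆ K ∧ (K \ W) ⊆ L ∧ p ∉ L := by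
    refine (hK.diff hW).induction_on
      (p := fun s => ∃ L : Set E, IsCompact L ∧ Convex ℝ L ∧ L ⊆ K ∧ s ⊆ L ∧ p ∉ L) ?_ ?_ ?_ ?_
    · exact ⟨∅, isCompact_empty, convex_empty, empty_subset _, Subset.rfl, fun h => h⟩
    · rintro s t hst ⟨L, h1, h2, h3, h4, h5⟩
      exact ⟨L, h1, h2, h3, hst.trans h4, h5⟩
    · rintro s t ⟨L, h1, h2, h3, h4, h5⟩ ⟨M, k1, k2, k3, k4, k5⟩
      -- The convex join with an empty set is empty, so it would lose the other set.
      rcases L.eq_empty_or_nonempty with rfl | hL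
      · exact ⟨M, k1, k2, k3, union_subset (h4.trans (empty_subset _)) k4, k5⟩
      rcases M.eq_empty_or_nonempty with rfl | hM
      · exact ⟨L, h1, h2, h3, union_subset h4 (k4.trans (empty_subset _)), h5⟩
      refine ⟨convexJoin ℝ L M, isCompact_convexJoin h1 k1, h2.convexJoin k2,
        convexJoin_subset h3 k3 hKc, union_subset (h4.trans (subset_convexJoin_left hM))
        (k4.trans (subset_convexJoin_right hL)),
        extremePoint_notMem_convexJoin hp h3 k3 h5 k5⟩
    · rintro x ⟨hxK, hxW⟩
      obtain ⟨f, hf⟩ := geometric_hahn_banach_point_point (x := p) (y := x)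
        (by rintro rfl; exact hxW hpW)
      obtain ⟨c, hc1, hc2⟩ := exists_between hf
      refine ⟨K ∩ {y | c ≤ f y}, ?_, K ∩ {y | c ≤ f y}, ?_, ?_, ?_,
        Subset.rfl, ?_⟩
      · have hc : {y | c ≤ f y} ∈ 𝓝 x :=
          Filter.mem_of_superset ((isOpen_lt continuous_const f.continuous).mem_nhds hc2)
            fun y (hy : c < f y) => hy.le
        exact Filter.inter_mem (Filter.mem_of_superset self_mem_nhdsWithin sdiff_subset)
          (mem_nhdsWithin_of_mem_nhds hc)
      · exact hK.inter_right (isClosed_le continuous_const f.continuous)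
      · exact hKc.inter (convex_halfSpace_ge f.toLinearMap.isLinear c)
      · exact inter_subset_left
      · exact fun h => hc1.not_ge h.2
  obtain ⟨L, hL, hLc, -, hWL, hpL⟩ := key
  obtain ⟨f, c, hf, hc⟩ := geometric_hahn_banach_closed_point hLc hL.isClosed hpL
  exact ⟨f, c, hc, fun x hx hcx => by_contra fun h => (hf x (hWL ⟨hx, h⟩)).not_ge hcx⟩

/-- The maximum of a continuous functional on a nonempty compact set is attained at an extreme
point. -/
theorem exists_extremePoint_le {K : Set E} (hK : IsCompact K) (f : StrongDual ℝ E) {x : E}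
    (hx : x ∈ K) : ∃ e ∈ K.extremePoints ℝ, f x ≤ f e := by
  obtain ⟨m, hm, hmax⟩ := hK.exists_isMaxOn ⟨x, hx⟩ f.continuous.continuousOn
  -- The maximizers of `f` form a compact exposed face, whose extreme points are extreme in `K`.
  have hexp : IsExposed ℝ K (f.toExposed K) := ContinuousLinearMap.toExposed.isExposed
  obtain ⟨e, he⟩ := (hexp.isCompact hK).extremePoints_nonempty ⟨m, hm, fun y hy => hmax hy⟩
  exact ⟨e, hexp.isExtreme.extremePoints_subset_extremePoints he,
    (extremePoints_subset he).2 x hx⟩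

end Convexity

/-! ### The weak-star dual as a real locally convex space -/

namespace WeakDual

variable {X : Type*} [NormedAddCommGroup X] [NormedSpace ℂ X]

/-- The pointwise real structure, as an instance that is found before `Module.complexToReal`. -/
noncomputable instance moduleReal : Module ℝ (WeakDual ℂ X) := WeakDual.instModule' ℝ

instance isScalarTower_real : IsScalarTower ℝ ℂ (WeakDual ℂ X) :=
  ⟨fun r z σ => ContinuousLinearMap.ext fun A => by
    change (r • z) • σ A = r • (z • σ A)
    exact smul_assoc _ _ _⟩

instance locallyConvexSpace_real : LocallyConvexSpace ℝ (WeakDual ℂ X) :=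
  (WeakDual.withSeminorms (𝕜 := ℂ) (E := X)).toLocallyConvexSpace

/-- Hahn-Banach separation by the evaluation at a vector. -/
theorem exists_re_lt_of_notMem {K : Set (WeakDual ℂ X)} (hK : Convex ℝ K) (hKc : IsClosed K)
    {σ : WeakDual ℂ X} (hσ : σ ∉ K) :
    ∃ (A : X) (c : ℝ), (∀ τ ∈ K, (τ A).re < c) ∧ c < (σ A).re := by
  obtain ⟨f, c, h1, h2⟩ := RCLike.geometric_hahn_banach_closed_point (𝕜 := ℂ) hK hKc hσ
  -- Every weak-star continuous functional is an evaluation.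
  obtain ⟨A, rfl⟩ := (topDualPairing ℂ X).dualEmbedding_surjective f
  exact ⟨A, c, h1, h2⟩

end WeakDual

/-! ### The hypertopology on convex sets and its comparison with the Vietoris topology -/

namespace Hyperspace

open TopologicalSpace

variable {X : Type*} [NormedAddCommGroup X] [NormedSpace ℂ X]

/-- The closure of the set of values of `F` at `A`. -/
noncomputable def values (F : Hyperspace X) (A : X) : Closeds ℂ :=
  Closeds.closure ((fun σ : WeakDual ℂ X => σ A) '' F.carrier)

theorem edist_values (F G : Hyperspace X) (A : X) : edist (F.values A) (G.values A) = dist A F G := by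
  rw [dist_eq, Closeds.edist_eq]
  exact Metric.hausdorffEDist_closure

theorem apply_mem_values {F : Hyperspace X} {σ : WeakDual ℂ X} (hσ : σ ∈ F.carrier) (A : X) :
    σ A ∈ F.values A :=
  subset_closure (mem_image_of_mem _ hσ)

theorem values_subset_iff {F : Hyperspace X} {A : X} {C : Set ℂ} (hC : IsClosed C) :
    (F.values A : Set ℂ) ⊆ C ↔ ∀ σ ∈ F.carrier, σ A ∈ C := by
  change closure _ ⊆ C ↔ _
  rw [hC.closure_subset_iff, image_subset_iff]
  rfl

/-- Each `d_H^(A)` is pulled back along `values` from the Hausdorff distance on closed subsets of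
`ℂ`, so the infimum of these topologies is induced from a product. -/
theorem isInducing_values : IsInducing (values : Hyperspace X → X → Closeds ℂ) := by
  refine ⟨?_⟩
  rw [Pi.topologicalSpace, induced_iInf]
  refine iInf_congr fun A => ?_
  rw [induced_compose]
  have : pseudoEMetric A = PseudoEMetricSpace.induced (fun F : Hyperspace X => F.values A)
      inferInstance := by
    ext F G
    exact (edist_values F G A).symm
  rw [this]
  rfl

theorem continuous_values (A : X) : Continuous fun F : Hyperspace X => F.values A :=
  (continuous_apply A).comp isInducing_values.continuous

theorem tendsto_iff_dist {ι : Type*} {l : Filter ι} {f : ι → Hyperspace X} {F : Hyperspace X} :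
    Filter.Tendsto f l (𝓝 F) ↔ ∀ A, Filter.Tendsto (fun i => dist A (f i) F) l (𝓝 0) := by
  rw [isInducing_values.tendsto_nhds_iff, tendsto_pi_nhds]
  refine forall_congr' fun A => ?_
  rw [tendsto_iff_edist_tendsto_0]
  simp only [Function.comp_apply, edist_values]

/-- A point of `F` outside `G` is separated from `G` by the real part of an evaluation at some `A`;
then a closed half-plane contains the values of `G` at `A` but not those of `F`. -/
theorem injOn_values : InjOn (values : Hyperspace X → X → Closeds ℂ) (CF X) := by
  have key : ∀ F ∈ CF X, ∀ G ∈ CF X, values F = values G → F.carrier ⊆ G.carrier := by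
    intro F hF G hG h σ hσ
    by_contra hσG
    obtain ⟨A, c, h1, h2⟩ := WeakDual.exists_re_lt_of_notMem hG G.isClosed hσG
    have hC : IsClosed {z : ℂ | z.re ≤ c} := isClosed_le Complex.continuous_re continuous_const
    have h3 := (values_subset_iff (A := A) hC).2 fun τ hτ => (h1 τ hτ).le
    rw [← h] at h3
    exact h2.not_ge (h3 (apply_mem_values hσ A))
  intro F hF G hG h
  exact Hyperspace.ext (Subset.antisymm (key F hF G hG h) (key G hG F hF h.symm))

instance t2Space_CF : T2Space (CF X) :=
  T2Space.of_injective_continuous (f := fun F : CF X => values F.1)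
    (fun F G h => Subtype.ext (injOn_values F.2 G.2 h))
    (isInducing_values.continuous.comp continuous_subtype_val)

/-- The nonempty convex weak-star closed subsets of `S`. -/
def convexIn (S : Set (WeakDual ℂ X)) : Set (Hyperspace X) :=
  {F | Convex ℝ F.carrier ∧ F.carrier ⊆ S}

theorem convexIn_subset_CF (S : Set (WeakDual ℂ X)) : convexIn S ⊆ CF X := fun _ h => h.1

instance t2Space_convexIn (S : Set (WeakDual ℂ X)) : T2Space (convexIn S) :=
  T2Space.of_injective_continuous (f := inclusion (convexIn_subset_CF S))
    (inclusion_injective _) (continuous_inclusion _)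

variable {S : Set (WeakDual ℂ X)}

/-- A nonempty compact subset of a subspace of the dual as a point of the hyperspace. -/
def ofCompacts (K : NonemptyCompacts S) : Hyperspace X where
  carrier := (↑) '' (K : Set S)
  nonempty := K.nonempty.image _
  isClosed := (K.isCompact.image continuous_subtype_val).isClosed

theorem values_ofCompacts (K : NonemptyCompacts S) (A : X) :
    (ofCompacts K).values A = (K.map (fun σ : S => (σ : WeakDual ℂ X) A)
      ((WeakDual.eval_continuous A).comp continuous_subtype_val)).toCloseds := by
  ext1
  change closure _ = _ '' _
  have h : (fun σ : WeakDual ℂ X => σ A) '' (ofCompacts K).carrier =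
      (fun σ : S => (σ : WeakDual ℂ X) A) '' (K : Set S) := (image_comp _ _ _).symm
  rw [h]
  exact (K.isCompact.image
    ((WeakDual.eval_continuous A).comp continuous_subtype_val)).isClosed.closure_eq

theorem continuous_ofCompacts : Continuous (ofCompacts : NonemptyCompacts S → Hyperspace X) := by
  rw [isInducing_values.continuous_iff, continuous_pi_iff]
  intro A
  simp only [Function.comp_apply, values_ofCompacts]
  exact NonemptyCompacts.continuous_toCloseds.comp
    ((WeakDual.eval_continuous A).comp continuous_subtype_val).nonemptyCompacts_map

/-- Failure of convexity is stable: if `a • x + b • y` lies outside `K`, it stays outside when `x`,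
`y` and `K` move slightly. -/
theorem isClosed_convex_compacts :
    IsClosed {K : NonemptyCompacts S | Convex ℝ ((↑) '' (K : Set S) : Set (WeakDual ℂ X))} := by
  rw [← isOpen_compl_iff, isOpen_iff_mem_nhds]
  intro K hK
  simp only [mem_compl_iff, mem_ofPred_eq, Convex, StarConvex] at hK
  push Not at hK
  obtain ⟨_, ⟨x, hx, rfl⟩, _, ⟨y, hy, rfl⟩, a, b, ha, hb, hab, hz⟩ := hK
  have hKc := K.isCompact.image (continuous_subtype_val (p := (· ∈ S)))
  obtain ⟨U, V, hU, hV, hzU, hKV, hUV⟩ := SeparatedNhds.of_isCompact_isCompact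
    isCompact_singleton hKc (disjoint_singleton_left.2 hz)
  have hg : Continuous fun q : S × S => a • (q.1 : WeakDual ℂ X) + b • (q.2 : WeakDual ℂ X) := by
    fun_prop
  obtain ⟨P, Q, hP, hQ, hxP, hyQ, hPQ⟩ := isOpen_prod_iff.1 (hU.preimage hg) x y
    (hzU (mem_singleton _))
  filter_upwards [(NonemptyCompacts.isOpen_inter_nonempty_of_isOpen hP).mem_nhds ⟨x, hx, hxP⟩,
    (NonemptyCompacts.isOpen_inter_nonempty_of_isOpen hQ).mem_nhds ⟨y, hy, hyQ⟩,
    (NonemptyCompacts.isOpen_subsets_of_isOpen (hV.preimage continuous_subtype_val)).mem_nhds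
      (image_subset_iff.1 hKV)] with L ⟨x', hx', hx'P⟩ ⟨y', hy', hy'Q⟩ hL hconv
  obtain ⟨w, hw, hwz⟩ := hconv (mem_image_of_mem _ hx') (mem_image_of_mem _ hy') ha hb hab
  have hwV : (w : WeakDual ℂ X) ∈ V := hL hw
  rw [hwz] at hwV
  exact disjoint_left.1 hUV (hPQ (mk_mem_prod hx'P hy'Q)) hwV

/-- The nonempty compact subsets of `S` that are convex. -/
abbrev ConvexCompacts (S : Set (WeakDual ℂ X)) : Type _ :=
  {K : NonemptyCompacts S // Convex ℝ ((↑) '' (K : Set S) : Set (WeakDual ℂ X))}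

/-- The convex compact subsets of a compact set `S`, with the Vietoris topology, are the points of
`convexIn S`. -/
noncomputable def convexCompactsHomeomorph (hS : IsCompact S) : ConvexCompacts S ≃ₜ convexIn S :=
  haveI : CompactSpace S := isCompact_iff_compactSpace.1 hS
  haveI : CompactSpace (ConvexCompacts S) :=
    isCompact_iff_compactSpace.1 isClosed_convex_compacts.isCompact
  Continuous.homeoOfEquivCompactToT2
    (f := Equiv.ofBijective
      (fun K : ConvexCompacts S => (⟨ofCompacts K.1, K.2, by
        rintro _ ⟨x, -, rfl⟩; exact x.2⟩ : convexIn S))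
      ⟨fun K L h => Subtype.ext (SetLike.coe_injective (Subtype.val_injective.image_injective
          (congrArg (fun F : convexIn S => F.1.carrier) h))),
        fun F => by
          have h : ((↑) '' ((↑) ⁻¹' F.1.carrier : Set S) : Set (WeakDual ℂ X)) = F.1.carrier := by
            rw [Subtype.image_preimage_coe, inter_eq_right.2 F.2.2]
          refine ⟨⟨⟨⟨(↑) ⁻¹' F.1.carrier, ?_⟩, ?_⟩, ?_⟩, ?_⟩
          · exact (F.1.isClosed.preimage continuous_subtype_val).isCompact
          · obtain ⟨σ, hσ⟩ := F.1.nonempty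
            exact ⟨⟨σ, F.2.2 hσ⟩, hσ⟩
          · exact h.symm ▸ F.2.1
          · exact Subtype.ext (Hyperspace.ext h)⟩)
    ((continuous_ofCompacts.comp continuous_subtype_val).subtype_mk _)

theorem carrier_convexCompactsHomeomorph (hS : IsCompact S) (K : ConvexCompacts S) :
    (convexCompactsHomeomorph hS K).1.carrier = (↑) '' (K.1 : Set S) := rfl

theorem compactSpace_convexIn (hS : IsCompact S) : CompactSpace (convexIn S) := by
  have : CompactSpace S := isCompact_iff_compactSpace.1 hS
  have : CompactSpace (ConvexCompacts S) :=
    isCompact_iff_compactSpace.1 isClosed_convex_compacts.isCompact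
  exact (convexCompactsHomeomorph hS).compactSpace

theorem metrizableSpace_convexIn [SeparableSpace X] (hS : IsCompact S) :
    MetrizableSpace (convexIn S) := by
  have : MetrizableSpace S := WeakDual.metrizable_of_isCompact ℂ X S hS
  let := metrizableSpaceMetric S
  exact (convexCompactsHomeomorph hS).symm.isEmbedding.metrizableSpace

theorem isCompletelyMetrizableSpace_convexIn [SeparableSpace X] (hS : IsCompact S) :
    IsCompletelyMetrizableSpace (convexIn S) := by
  have := compactSpace_convexIn hS
  have := metrizableSpace_convexIn hS
  let := metrizableSpaceMetric (convexIn S)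
  infer_instance

theorem isOpen_subset_convexIn (hS : IsCompact S) {U : Set (WeakDual ℂ X)} (hU : IsOpen U) :
    IsOpen {F : convexIn S | F.1.carrier ⊆ U} := by
  rw [← (convexCompactsHomeomorph hS).isOpen_preimage]
  convert (NonemptyCompacts.isOpen_subsets_of_isOpen
    (hU.preimage continuous_subtype_val)).preimage
      (continuous_subtype_val : Continuous ((↑) : ConvexCompacts S → NonemptyCompacts S)) using 1
  ext K
  simp [carrier_convexCompactsHomeomorph]

theorem isOpen_inter_nonempty_convexIn (hS : IsCompact S) {U : Set (WeakDual ℂ X)}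
    (hU : IsOpen U) : IsOpen {F : convexIn S | (F.1.carrier ∩ U).Nonempty} := by
  rw [← (convexCompactsHomeomorph hS).isOpen_preimage]
  convert (NonemptyCompacts.isOpen_inter_nonempty_of_isOpen
    (hU.preimage continuous_subtype_val)).preimage
      (continuous_subtype_val : Continuous ((↑) : ConvexCompacts S → NonemptyCompacts S)) using 1
  ext K
  simp only [mem_preimage, mem_ofPred_eq, carrier_convexCompactsHomeomorph]
  rw [← image_inter_preimage, image_nonempty]

/-- A convex set near one with an extreme point in an open set `W` has an extreme point in `W`. -/
theorem isOpen_extremePoints_inter_nonempty (hS : IsCompact S) {W : Set (WeakDual ℂ X)}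
    (hW : IsOpen W) :
    IsOpen {F : convexIn S | (F.1.carrier.extremePoints ℝ ∩ W).Nonempty} := by
  rw [isOpen_iff_mem_nhds]
  rintro F ⟨p, hp, hpW⟩
  have hcpt : ∀ G : convexIn S, IsCompact G.1.carrier := fun G =>
    hS.of_isClosed_subset G.1.isClosed G.2.2
  obtain ⟨f, c, hc, hf⟩ := exists_slice_subset_of_mem_extremePoints (hcpt F) F.2.1 hp hW hpW
  -- If `G` lies in this open set and meets `{c < f}`, then `f` exceeds `c` at some extreme point of
  -- `G`, which must then be in `W`.
  have hU : IsOpen (W ∪ {x | f x < c}) := hW.union (isOpen_lt f.continuous continuous_const)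
  have hV : IsOpen {x | c < f x} := isOpen_lt continuous_const f.continuous
  filter_upwards [(isOpen_subset_convexIn hS hU).mem_nhds fun x hx =>
      (le_or_gt c (f x)).imp (hf x hx) id,
    (isOpen_inter_nonempty_convexIn hS hV).mem_nhds ⟨p, extremePoints_subset hp, hc⟩]
    with G hG ⟨x, hx, hxc⟩
  obtain ⟨e, he, hxe⟩ := exists_extremePoint_le (hcpt G) f hx
  exact ⟨e, he, (hG (extremePoints_subset he)).resolve_right
    (hxc.trans_le hxe).le.not_gt⟩

end Hyperspace

/-! ### Approximation by polytopes and the Baire argument -/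

namespace Hyperspace

open TopologicalSpace

variable {X : Type*} [NormedAddCommGroup X] [NormedSpace ℂ X]

theorem enorm_sub_self_apply (σ : WeakDual ℂ X) (A : X) : ‖(σ - σ) A‖ₑ = 0 := by
  rw [sub_self, enorm_eq_zero]
  rfl

theorem dist_le {A : X} {F G : Hyperspace X} {r : ENNReal}
    (h₁ : ∀ σ ∈ F.carrier, ∃ τ ∈ G.carrier, ‖(σ - τ) A‖ₑ ≤ r)
    (h₂ : ∀ τ ∈ G.carrier, ∃ σ ∈ F.carrier, ‖(σ - τ) A‖ₑ ≤ r) : dist A F G ≤ r := by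
  refine max_le (iSup₂_le fun σ hσ => ?_) (iSup₂_le fun τ hτ => ?_)
  · obtain ⟨τ, hτ, h⟩ := h₁ σ hσ
    exact (iInf₂_le τ hτ).trans h
  · obtain ⟨σ, hσ, h⟩ := h₂ τ hτ
    exact (iInf₂_le σ hσ).trans h

/-- The convex hull of a nonempty finite set of functionals. -/
def polytope (T : Set (WeakDual ℂ X)) (hT : T.Finite) (hT' : T.Nonempty) : Hyperspace X where
  carrier := convexHull ℝ T
  nonempty := hT'.convexHull
  isClosed := hT.isClosed_convexHull ℝ

theorem polytope_mem_convexIn {S T : Set (WeakDual ℂ X)} (hS : Convex ℝ S) (hT : T.Finite)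
    (hT' : T.Nonempty) (h : T ⊆ S) : polytope T hT hT' ∈ convexIn S :=
  ⟨convex_convexHull ℝ T, convexHull_min h hS⟩

/-- A convex weak-star compact set is a limit of polytopes spanned by its points, which may be
taken to contain a given point. -/
theorem mem_closure_polytopes {F : Hyperspace X} (hF : F ∈ CK X) {σ : WeakDual ℂ X}
    (hσ : σ ∈ F.carrier) :
    F ∈ closure {P | ∃ (T : Set (WeakDual ℂ X)) (hT : T.Finite) (hT' : T.Nonempty),
      T ⊆ F.carrier ∧ σ ∈ T ∧ P = polytope T hT hT'} := by
  classical
  let f : Finset F.carrier → Hyperspace X := fun t =>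
    polytope (insert σ ((↑) '' (t : Set F.carrier))) ((t.finite_toSet.image _).insert σ)
      (insert_nonempty _ _)
  have hsub : ∀ t : Finset F.carrier,
      insert σ ((↑) '' (t : Set F.carrier) : Set (WeakDual ℂ X)) ⊆ F.carrier := fun t =>
    insert_subset hσ (by rintro _ ⟨x, -, rfl⟩; exact x.2)
  -- The polytopes lie in `F`, so only one half of the Hausdorff distance matters; a finite subcover
  -- of `F` by slabs of radius `r` at `A` bounds it.
  have hf : Filter.Tendsto f Filter.atTop (𝓝 F) := by
    rw [tendsto_iff_dist]
    intro A
    rw [ENNReal.tendsto_nhds_zero]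
    intro r hr
    obtain ⟨t, ht⟩ := hF.2.elim_nhds_subcover'
      (fun τ _ => {σ : WeakDual ℂ X | ‖(τ - σ) A‖ₑ < r}) fun τ hτ =>
        (isOpen_lt (WeakDual.eval_continuous A |>.comp (continuous_const.sub continuous_id)
          |>.enorm) continuous_const).mem_nhds (by
          change ‖(τ - τ) A‖ₑ < r
          rwa [enorm_sub_self_apply])
    filter_upwards [Filter.eventually_ge_atTop t] with t' ht'
    refine dist_le (fun τ hτ => ⟨τ, convexHull_min (hsub t') hF.1 hτ, by simp [enorm_sub_self_apply, -sub_self]⟩) fun τ hτ => ?_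
    have hτ' := ht hτ
    simp only [mem_iUnion, exists_prop] at hτ'
    obtain ⟨x, hx, hxτ⟩ := hτ'
    exact ⟨x, subset_convexHull ℝ _ (mem_insert_of_mem _ (mem_image_of_mem _ (ht' hx))),
      le_of_lt hxτ⟩
  exact mem_closure_of_tendsto hf (Filter.Eventually.of_forall fun t =>
    ⟨_, _, _, hsub t, mem_insert _ _, rfl⟩)

theorem dist_polytope_insert_le {T : Set (WeakDual ℂ X)} (hT : T.Finite) (hT' : T.Nonempty)
    {σ : WeakDual ℂ X} (hσ : σ ∈ T) (p : WeakDual ℂ X) (A : X) :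
    dist A (polytope (insert p T) (hT.insert p) (insert_nonempty _ _)) (polytope T hT hT') ≤
      ‖(p - σ) A‖ₑ := by
  refine dist_le (fun x hx => ?_) fun τ hτ => ⟨τ, convexHull_mono (subset_insert _ _) hτ, by
    simp [enorm_sub_self_apply, -sub_self]⟩
  change x ∈ convexHull ℝ (insert p T) at hx
  rw [convexHull_insert hT', convexJoin_singleton_left] at hx
  obtain ⟨k, hk, a, b, ha, hb, hab, rfl⟩ := mem_iUnion₂.1 hx
  -- Replacing the vertex `p` by `σ` moves the point by `a • (p - σ)` with `a ≤ 1`.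
  refine ⟨a • σ + b • k, convex_convexHull ℝ T (subset_convexHull ℝ T hσ) hk ha hb hab, ?_⟩
  have h : a • p + b • k - (a • σ + b • k) = a • (p - σ) := by module
  rw [h]
  change ‖a • (p - σ) A‖ₑ ≤ _
  rw [enorm_smul]
  refine mul_le_of_le_one_left' ?_
  rw [Real.enorm_eq_ofReal ha]
  exact ENNReal.ofReal_le_one.2 (by linarith)

variable {S : Set (WeakDual ℂ X)}

/-- A polytope in `S` can be perturbed in `S` so that a given point becomes extreme. -/
theorem polytope_mem_closure (hS : Convex ℝ S)
    (hspan : ∀ T : Set (WeakDual ℂ X), T.Finite → ∃ φ ∈ S, φ ∉ Submodule.span ℂ T)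
    {T : Set (WeakDual ℂ X)} (hT : T.Finite) (hT' : T.Nonempty) (hTS : T ⊆ S)
    {σ : WeakDual ℂ X} (hσ : σ ∈ T) {W : Set (WeakDual ℂ X)} (hW : IsOpen W) (hσW : σ ∈ W) :
    polytope T hT hT' ∈
      closure (convexIn S ∩ {F | (F.carrier.extremePoints ℝ ∩ W).Nonempty}) := by
  obtain ⟨φ, hφS, hφ⟩ := hspan T hT
  let p : ℝ → WeakDual ℂ X := fun r => σ + r • (φ - σ)
  have hp : Continuous p := by fun_prop
  have hp0 : p 0 = σ := by simp [p]
  have hlim : Filter.Tendsto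
      (fun r => polytope (insert (p r) T) (hT.insert _) (insert_nonempty _ _)) (𝓝[>] 0)
      (𝓝 (polytope T hT hT')) := by
    rw [tendsto_iff_dist]
    intro A
    refine tendsto_of_tendsto_of_tendsto_of_le_of_le tendsto_const_nhds ?_ (fun _ => zero_le)
      fun r => dist_polytope_insert_le hT hT' hσ (p r) A
    have hc : Continuous fun r => ‖(p r - σ) A‖ₑ :=
      ((WeakDual.eval_continuous A).comp (hp.sub continuous_const)).enorm
    have := (hc.tendsto 0).mono_left (nhdsWithin_le_nhds (s := Ioi 0))
    simpa [hp0, enorm_sub_self_apply, -sub_self] using this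
  refine mem_closure_of_tendsto hlim ?_
  have hWr : ∀ᶠ r in 𝓝[>] (0 : ℝ), p r ∈ W :=
    ((hp.tendsto 0).eventually (hW.mem_nhds (hp0.symm ▸ hσW))).filter_mono nhdsWithin_le_nhds
  filter_upwards [hWr, Ioo_mem_nhdsGT one_pos] with r hrW ⟨hr0, hr1⟩
  have hpS : p r ∈ S := hS.add_smul_sub_mem (hTS hσ) hφS ⟨hr0.le, hr1.le⟩
  refine ⟨polytope_mem_convexIn hS _ _ (insert_subset hpS hTS), p r,
    mem_extremePoints_convexHull_insert fun h => hφ ?_, hrW⟩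
  -- If `p r` were in the hull of `T`, it would lie in the span of `T`; since `σ` does too and `r ≠
  -- 0`, so would `φ`.
  let V : Submodule ℝ (WeakDual ℂ X) := (Submodule.span ℂ T).restrictScalars ℝ
  have hTV : T ⊆ V := Submodule.subset_span (R := ℂ)
  have hpV : p r ∈ V := convexHull_min hTV V.convex h
  have hσV : σ ∈ V := hTV hσ
  have h1 : r • (φ - σ) ∈ V := by simpa [p] using V.sub_mem hpV hσV
  have h2 : φ - σ ∈ V := (V.smul_mem_iff hr0.ne').1 h1
  have h3 : φ ∈ V := by simpa using V.add_mem h2 hσV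
  exact h3

/-- Only sets meeting `W` need approximation: choose `σ` in the intersection, pass to polytopes
generated by finite sets containing `σ`, then perturb these. -/
theorem dense_disjoint_or_extremePoints (hSc : IsCompact S) (hS : Convex ℝ S)
    (hspan : ∀ T : Set (WeakDual ℂ X), T.Finite → ∃ φ ∈ S, φ ∉ Submodule.span ℂ T)
    {W : Set (WeakDual ℂ X)} (hW : IsOpen W) :
    Dense {F : convexIn S | ¬ (F.1.carrier ∩ W).Nonempty ∨
      (F.1.carrier.extremePoints ℝ ∩ W).Nonempty} := by
  intro F
  by_cases hF : (F.1.carrier ∩ W).Nonempty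
  · obtain ⟨σ, hσ, hσW⟩ := hF
    refine closure_mono (fun G hG => Or.inr hG : {G : convexIn S |
      (G.1.carrier.extremePoints ℝ ∩ W).Nonempty} ⊆ _) ?_
    rw [closure_subtype]
    have h := mem_closure_polytopes
      ⟨F.2.1, hSc.of_isClosed_subset F.1.isClosed F.2.2⟩ hσ
    refine closure_minimal ?_ isClosed_closure h
    rintro _ ⟨T, hT, hT', hTF, hσT, rfl⟩
    refine closure_mono ?_ (polytope_mem_closure hS hspan hT hT' (hTF.trans F.2.2) hσT hW hσW)
    exact fun G hG => ⟨⟨G, hG.1⟩, hG.2, rfl⟩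
  · exact subset_closure (Or.inl hF)

/-- The points of `convexIn S` that are the closure of their extreme points form a dense `G_δ`
set. -/
theorem dense_isGδ_closure_extremePoints [SeparableSpace X] (hSc : IsCompact S)
    (hS : Convex ℝ S)
    (hspan : ∀ T : Set (WeakDual ℂ X), T.Finite → ∃ φ ∈ S, φ ∉ Submodule.span ℂ T) :
    Dense {F : convexIn S | F.1.carrier = closure (F.1.carrier.extremePoints ℝ)} ∧
      IsGδ {F : convexIn S | F.1.carrier = closure (F.1.carrier.extremePoints ℝ)} := by
  have : MetrizableSpace S := WeakDual.metrizable_of_isCompact ℂ X S hSc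
  have : CompactSpace S := isCompact_iff_compactSpace.1 hSc
  have : MetrizableSpace (convexIn S) := metrizableSpace_convexIn hSc
  have : CompactSpace (convexIn S) := compactSpace_convexIn hSc
  have : SecondCountableTopology S := by
    let := metrizableSpaceMetric S
    infer_instance
  let := metrizableSpaceMetric (convexIn S)
  have hW : ∀ b : countableBasis S, ∃ W : Set (WeakDual ℂ X), IsOpen W ∧ (↑) ⁻¹' W = b.1 :=
    fun b => isOpen_induced_iff.1 (isOpen_of_mem_countableBasis b.2)
  choose W hWo hWb using hW
  have heq : {F : convexIn S | F.1.carrier = closure (F.1.carrier.extremePoints ℝ)} =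
      ⋂ b, {F : convexIn S | ¬ (F.1.carrier ∩ W b).Nonempty ∨
        (F.1.carrier.extremePoints ℝ ∩ W b).Nonempty} := by
    ext F
    simp only [mem_ofPred_eq, mem_iInter]
    constructor
    · intro h b
      by_cases hb : (F.1.carrier ∩ W b).Nonempty
      · obtain ⟨σ, hσ, hσb⟩ := hb
        rw [h] at hσ
        exact Or.inr ((mem_closure_iff.1 hσ _ (hWo b) hσb).mono (inter_comm _ _).subset)
      · exact Or.inl hb
    · intro h
      refine Subset.antisymm (fun σ hσ => mem_closure_iff.2 fun U hU hσU => ?_)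
        (closure_minimal extremePoints_subset F.1.isClosed)
      obtain ⟨b, hb, hσb, hbU⟩ := (isBasis_countableBasis S).exists_subset_of_mem_open
        (a := (⟨σ, F.2.2 hσ⟩ : S)) (u := Subtype.val ⁻¹' U) hσU (hU.preimage continuous_subtype_val)
      have hσW : σ ∈ W ⟨b, hb⟩ := by
        have : (⟨σ, F.2.2 hσ⟩ : S) ∈ ((↑) ⁻¹' W ⟨b, hb⟩ : Set S) := by rw [hWb]; exact hσb
        exact this
      obtain ⟨e, he, heW⟩ := (h ⟨b, hb⟩).resolve_left (not_not.2 ⟨σ, hσ, hσW⟩)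
      refine ⟨e, ?_, he⟩
      have heS : e ∈ S := F.2.2 (extremePoints_subset he)
      have : (⟨e, heS⟩ : S) ∈ b := (hWb ⟨b, hb⟩).subset heW
      exact hbU this
  have hG : ∀ b, IsGδ {F : convexIn S | ¬ (F.1.carrier ∩ W b).Nonempty ∨
        (F.1.carrier.extremePoints ℝ ∩ W b).Nonempty} := fun b =>
    IsGδ.union (isOpen_inter_nonempty_convexIn hSc (hWo b)).isClosed_compl.isGδ
      (isOpen_extremePoints_inter_nonempty hSc (hWo b)).isGδ
  have : Countable (countableBasis S) := (countable_countableBasis S).to_subtype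
  rw [heq]
  exact ⟨dense_iInter_of_Gδ hG fun b => dense_disjoint_or_extremePoints hSc hS hspan (hWo b),
    IsGδ.iInter hG⟩

end Hyperspace

/-! ### Positive functionals and states -/

namespace Hyperspace

open TopologicalSpace

variable {X : Type*} [CStarAlgebra X]

section Order

open scoped ComplexOrder

theorem apply_nonneg_of_mem_positiveDual [PartialOrder X] [StarOrderedRing X] {σ : WeakDual ℂ X}
    (hσ : σ ∈ positiveDual X) {A : X} (hA : 0 ≤ A) : 0 ≤ σ A := by
  rw [StarOrderedRing.nonneg_iff] at hA
  induction hA using AddSubmonoid.closure_induction with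
  | mem x hx =>
    obtain ⟨s, rfl⟩ := hx
    simpa using hσ (star s)
  | zero => simp
  | add x y _ _ hx hy => rw [map_add]; exact add_nonneg hx hy

/-- Cauchy-Schwarz in the pre-GNS space: `|σ(A)|² ≤ σ(1) σ(A*A) ≤ σ(1)² ‖A‖²`. -/
theorem norm_apply_le_of_mem_positiveDual {σ : WeakDual ℂ X} (hσ : σ ∈ positiveDual X) (A : X) :
    ‖σ A‖ ≤ ‖σ 1‖ * ‖A‖ := by
  let _ := CStarAlgebra.spectralOrder X
  let _ := CStarAlgebra.spectralOrderedRing X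
  let f : X →ₚ[ℂ] ℂ := PositiveLinearMap.mk₀ (WeakDual.toStrongDual σ).toLinearMap
    fun x hx => apply_nonneg_of_mem_positiveDual hσ hx
  have hf : ∀ x, f x = σ x := fun _ => rfl
  have h1 : ‖f.toPreGNS 1‖ ^ 2 = ‖σ 1‖ := by
    have := congrArg norm (f.preGNS_norm_sq (f.toPreGNS 1))
    simpa [hf] using this
  have h2 : ‖f.toPreGNS A‖ ^ 2 ≤ ‖σ 1‖ * ‖A‖ ^ 2 := by
    have h := congrArg norm (f.preGNS_norm_sq (f.toPreGNS A))
    have h' := f.norm_apply_le_of_nonneg (star A * A) (star_mul_self_nonneg A)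
    rw [CStarRing.norm_star_mul_self, ← sq] at h'
    have h'' : ‖f (star A * A)‖ ≤ ‖σ 1‖ * ‖A‖ ^ 2 := h'
    exact (by simpa using h : ‖f.toPreGNS A‖ ^ 2 = ‖f (star A * A)‖).le.trans h''
  have h3 : ‖σ A‖ ≤ ‖f.toPreGNS 1‖ * ‖f.toPreGNS A‖ := by
    have := norm_inner_le_norm (𝕜 := ℂ) (f.toPreGNS 1) (f.toPreGNS A)
    rw [f.preGNS_inner_def] at this
    simpa [hf] using this
  refine (sq_le_sq₀ (norm_nonneg _) (by positivity)).1 ?_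
  calc ‖σ A‖ ^ 2 ≤ (‖f.toPreGNS 1‖ * ‖f.toPreGNS A‖) ^ 2 := by gcongr
    _ = ‖σ 1‖ * ‖f.toPreGNS A‖ ^ 2 := by rw [mul_pow, h1]
    _ ≤ ‖σ 1‖ * (‖σ 1‖ * ‖A‖ ^ 2) := by gcongr
    _ = (‖σ 1‖ * ‖A‖) ^ 2 := by ring

/-- The norm of a positive functional is its value at the unit. -/
theorem apply_one_eq_norm {σ : WeakDual ℂ X} (hσ : σ ∈ positiveDual X) :
    σ 1 = (‖WeakDual.toStrongDual σ‖ : ℂ) := by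
  have h0 : 0 ≤ σ 1 := by simpa using hσ 1
  have h1 : ‖(1 : X)‖ ≤ 1 := by
    rcases subsingleton_or_nontrivial X with h | h
    · simp [Subsingleton.elim (1 : X) 0]
    · exact CStarRing.norm_one.le
  have h2 : ‖WeakDual.toStrongDual σ‖ = ‖σ 1‖ := by
    refine le_antisymm (ContinuousLinearMap.opNorm_le_bound _ (norm_nonneg _) fun A =>
      norm_apply_le_of_mem_positiveDual hσ A) ?_
    exact ((WeakDual.toStrongDual σ).le_opNorm 1).trans
      (mul_le_of_le_one_right (norm_nonneg _) h1)
  rw [h2]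
  exact (RCLike.norm_of_nonneg' h0).symm

theorem isClosed_positiveDual : IsClosed (positiveDual X) := by
  have : positiveDual X = ⋂ A : X, {σ : WeakDual ℂ X | 0 ≤ σ (A * star A)} := by
    ext; simp [positiveDual]
  rw [this]
  exact isClosed_iInter fun A => isClosed_le continuous_const (WeakDual.eval_continuous _)

theorem convex_positiveDual : Convex ℝ (positiveDual X) := by
  intro σ hσ τ hτ a b ha hb _ A
  change 0 ≤ a • σ (A * star A) + b • τ (A * star A)
  exact add_nonneg (smul_nonneg ha (hσ A)) (smul_nonneg hb (hτ A))

theorem smul_mem_positiveDual {σ : WeakDual ℂ X} (hσ : σ ∈ positiveDual X) {r : ℝ} (hr : 0 ≤ r) :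
    r • σ ∈ positiveDual X := fun A => smul_nonneg hr (hσ A)

end Order

/-- The positive functionals of norm at most `r`. -/
noncomputable def positiveBall (X : Type*) [CStarAlgebra X] (r : ℝ) : Set (WeakDual ℂ X) :=
  {σ | σ ∈ positiveDual X ∧ ‖WeakDual.toStrongDual σ‖ ≤ r}

theorem isCompact_positiveBall (r : ℝ) : IsCompact (positiveBall X r) := by
  have : positiveBall X r =
      (WeakDual.toStrongDual ⁻¹' Metric.closedBall 0 r) ∩ positiveDual X := by
    ext σ; simp [positiveBall, and_comm]
  rw [this]
  exact (WeakDual.isCompact_closedBall 0 r).inter_right isClosed_positiveDual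

theorem convex_positiveBall (r : ℝ) : Convex ℝ (positiveBall X r) := by
  intro σ hσ τ hτ a b ha hb hab
  refine ⟨convex_positiveDual hσ.1 hτ.1 ha hb hab, ?_⟩
  have := convex_closedBall (0 : StrongDual ℂ X) r
    (by simpa using hσ.2) (by simpa using hτ.2) ha hb hab
  rwa [mem_closedBall_zero_iff] at this

/-- Trades the condition of norm one for the affine, weak-star closed condition `σ 1 = 1`;
compactness and convexity of the state space follow. -/
theorem mem_stateSpace_iff {σ : WeakDual ℂ X} :
    σ ∈ stateSpace X ↔ σ ∈ positiveBall X 1 ∧ σ 1 = 1 := by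
  constructor
  · intro h
    exact ⟨⟨h.1, h.2.le⟩, by rw [apply_one_eq_norm h.1, h.2]; simp⟩
  · intro h
    refine ⟨h.1.1, ?_⟩
    have := apply_one_eq_norm h.1.1
    rw [h.2] at this
    exact_mod_cast this.symm

theorem isCompact_stateSpace : IsCompact (stateSpace X) := by
  have : stateSpace X = positiveBall X 1 ∩ {σ | σ 1 = 1} := by
    ext σ; exact mem_stateSpace_iff
  rw [this]
  exact (isCompact_positiveBall 1).inter_right
    (isClosed_eq (WeakDual.eval_continuous _) continuous_const)

theorem convex_stateSpace : Convex ℝ (stateSpace X) := by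
  intro σ hσ τ hτ a b ha hb hab
  rw [mem_stateSpace_iff] at *
  refine ⟨convex_positiveBall 1 hσ.1 hτ.1 ha hb hab, ?_⟩
  change a • σ 1 + b • τ 1 = 1
  rw [hσ.2, hτ.2, ← add_smul, hab, one_smul]

section Separation

open scoped ComplexOrder

/-- A self-adjoint element that is not positive is negative under some positive functional. -/
theorem exists_positive_re_neg [PartialOrder X] [StarOrderedRing X] {c : X}
    (hc : IsSelfAdjoint c) (hc' : ¬ 0 ≤ c) : ∃ φ ∈ positiveDual X, (φ c).re < 0 := by
  let C : ProperCone ℝ X :=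
    { carrier := {a | 0 ≤ a}
      add_mem' := fun ha hb => add_nonneg ha hb
      zero_mem' := le_refl (0 : X)
      smul_mem' := fun r _ ha => smul_nonneg r.2 ha
      isClosed' := isClosed_le continuous_const continuous_id }
  obtain ⟨f, hf, hfc⟩ := C.hyperplane_separation_point (x₀ := c) hc'
  -- Symmetrizing under `star` makes `g` vanish on `I • x` for self-adjoint `x`, so its complex
  -- extension agrees with `f` there.
  let g : StrongDual ℝ X := (2⁻¹ : ℝ) • (f + f.comp (starL' ℝ : X ≃L[ℝ] X).toContinuousLinearMap)
  have hg : ∀ x, g x = 2⁻¹ * (f x + f (star x)) := fun _ => rfl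
  let φ : WeakDual ℂ X := WeakDual.extendRCLikeL (StrongDual.toWeakDual g)
  have hφ : ∀ x, IsSelfAdjoint x → φ x = f x := by
    intro x hx
    have h1 : g x = f x := by rw [hg, hx.star_eq]; ring
    have h2 : g (Complex.I • x) = 0 := by
      rw [hg, star_smul, hx.star_eq]
      simp
    have h3 : φ x = g x - Complex.I • (g (Complex.I • x) : ℂ) := rfl
    rw [h3, h1, h2]; simp
  refine ⟨φ, fun A => ?_, ?_⟩
  · rw [hφ _ (IsSelfAdjoint.mul_star_self A)]
    exact_mod_cast hf _ (mul_star_self_nonneg A)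
  · rw [hφ c hc]; simpa using hfc

theorem exists_state_apply_ne_zero_of_isSelfAdjoint {b : X} (hb : IsSelfAdjoint b) (hb0 : b ≠ 0) :
    ∃ φ ∈ stateSpace X, φ b ≠ 0 := by
  let _ := CStarAlgebra.spectralOrder X
  let _ := CStarAlgebra.spectralOrderedRing X
  have h : ∃ φ ∈ positiveDual X, φ b ≠ 0 := by
    by_cases h : 0 ≤ b
    · have h' : ¬ 0 ≤ -b := fun h' => hb0 (le_antisymm (neg_nonneg.1 h') h)
      obtain ⟨φ, hφ, hlt⟩ := exists_positive_re_neg hb.neg h'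
      exact ⟨φ, hφ, fun h0 => by simp [h0] at hlt⟩
    · obtain ⟨φ, hφ, hlt⟩ := exists_positive_re_neg hb h
      exact ⟨φ, hφ, fun h0 => by simp [h0] at hlt⟩
  obtain ⟨φ, hφ, hne⟩ := h
  have hn : ‖WeakDual.toStrongDual φ‖ ≠ 0 := fun h0 => hne <| by
    have := norm_apply_le_of_mem_positiveDual hφ b
    rw [apply_one_eq_norm hφ, h0] at this
    simpa using this
  refine ⟨‖WeakDual.toStrongDual φ‖⁻¹ • φ,
    ⟨smul_mem_positiveDual hφ (by positivity), ?_⟩, ?_⟩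
  · have : WeakDual.toStrongDual (‖WeakDual.toStrongDual φ‖⁻¹ • φ) =
        ‖WeakDual.toStrongDual φ‖⁻¹ • WeakDual.toStrongDual φ := rfl
    rw [this, norm_smul, norm_inv, norm_norm, inv_mul_cancel₀ hn]
  · change ‖WeakDual.toStrongDual φ‖⁻¹ • φ b ≠ 0
    exact smul_ne_zero (inv_ne_zero hn) hne

theorem im_apply_of_isSelfAdjoint {φ : WeakDual ℂ X} (hφ : φ ∈ positiveDual X) {b : X}
    (hb : IsSelfAdjoint b) : (φ b).im = 0 := by
  let _ := CStarAlgebra.spectralOrder X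
  let _ := CStarAlgebra.spectralOrderedRing X
  let f : X →ₚ[ℂ] ℂ := PositiveLinearMap.mk₀ (WeakDual.toStrongDual φ).toLinearMap
    fun x hx => apply_nonneg_of_mem_positiveDual hφ hx
  have h : star (f b) = f b := by rw [← map_star, hb.star_eq]
  exact Complex.conj_eq_iff_im.1 h

/-- The states separate the points of a C*-algebra. -/
theorem eq_zero_of_forall_state {a : X} (h : ∀ φ ∈ stateSpace X, φ a = 0) : a = 0 := by
  -- States are real on self-adjoint elements, so `φ a = 0` splits into two real equations.
  have key : ∀ φ ∈ stateSpace X, φ (realPart a : X) = 0 ∧ φ (imaginaryPart a : X) = 0 := by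
    intro φ hφ
    have h1 := im_apply_of_isSelfAdjoint hφ.1 (realPart a).2
    have h2 := im_apply_of_isSelfAdjoint hφ.1 (imaginaryPart a).2
    have h3 : φ (realPart a : X) + Complex.I * φ (imaginaryPart a : X) = 0 := by
      have := h φ hφ
      rw [← realPart_add_I_smul_imaginaryPart a, map_add, map_smul] at this
      simpa using this
    have h4 := congrArg Complex.re h3
    have h5 := congrArg Complex.im h3
    simp [h1, h2] at h4 h5
    exact ⟨Complex.ext h4 h1, Complex.ext h5 h2⟩
  have hr : (realPart a : X) = 0 := by
    by_contra h0
    obtain ⟨φ, hφ, hne⟩ := exists_state_apply_ne_zero_of_isSelfAdjoint (realPart a).2 h0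
    exact hne (key φ hφ).1
  have hi : (imaginaryPart a : X) = 0 := by
    by_contra h0
    obtain ⟨φ, hφ, hne⟩ := exists_state_apply_ne_zero_of_isSelfAdjoint (imaginaryPart a).2 h0
    exact hne (key φ hφ).2
  rw [← realPart_add_I_smul_imaginaryPart a, hr, hi]
  simp

/-- The states of an infinite-dimensional C*-algebra span an infinite-dimensional space. -/
theorem exists_state_notMem_span (hX : ¬ FiniteDimensional ℂ X) {T : Set (WeakDual ℂ X)}
    (hT : T.Finite) : ∃ φ ∈ stateSpace X, φ ∉ Submodule.span ℂ T := by
  by_contra! h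
  have : Finite T := hT
  -- If `T` spanned all states, a vector killed by `T` would be killed by every state, so `X` would
  -- embed in `ℂ^T`.
  let ev : X →ₗ[ℂ] (T → ℂ) := LinearMap.pi fun τ : T => (WeakDual.toStrongDual τ.1).toLinearMap
  refine hX (FiniteDimensional.of_injective ev ((injective_iff_map_eq_zero ev).2 fun A hA => ?_))
  refine eq_zero_of_forall_state fun φ hφ => ?_
  have hφT := h φ hφ
  clear hφ
  induction hφT using Submodule.span_induction with
  | mem τ hτ => exact congrFun hA ⟨τ, hτ⟩
  | zero => rfl
  | add σ τ _ _ hs ht =>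
    change σ A + τ A = 0
    rw [hs, ht, add_zero]
  | smul c σ _ hs =>
    change c • σ A = 0
    rw [hs, smul_zero]

end Separation

end Hyperspace

/-! ### Exhaustion by balls and the main theorem -/

/-- A set is `G_δ` if its traces on the members of a countable closed cover are. -/
theorem IsGδ.of_isClosedEmbedding_cover {Y : Type*} [TopologicalSpace Y] {Z : ℕ → Type*}
    [∀ n, TopologicalSpace (Z n)] {f : ∀ n, Z n → Y} (hf : ∀ n, IsClosedEmbedding (f n))
    (hcov : ∀ y, ∃ n, y ∈ range (f n)) {D : Set Y} (hD : ∀ n, IsGδ (f n ⁻¹' D)) : IsGδ D := by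
  have h : ∀ n, ∃ U : ℕ → Set Y, (∀ k, IsOpen (U k)) ∧ f n ⁻¹' D = ⋂ k, f n ⁻¹' U k := by
    intro n
    obtain ⟨O, hO, hOD⟩ := isGδ_iff_eq_iInter_nat.1 (hD n)
    choose U hU hUO using fun k => (hf n).isInducing.isOpen_iff.1 (hO k)
    exact ⟨U, hU, hOD.trans (iInter_congr fun k => (hUO k).symm)⟩
  choose U hU hUD using h
  have : D = ⋂ (n) (k), ((range (f n))ᶜ ∪ U n k) := by
    ext y
    simp only [mem_iInter, mem_union, mem_compl_iff]
    constructor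
    · intro hy n k
      by_cases hn : y ∈ range (f n)
      · obtain ⟨z, rfl⟩ := hn
        have hz : z ∈ f n ⁻¹' D := hy
        rw [hUD, mem_iInter] at hz
        exact Or.inr (hz k)
      · exact Or.inl hn
    · intro hy
      obtain ⟨n, z, rfl⟩ := hcov y
      change z ∈ f n ⁻¹' D
      rw [hUD, mem_iInter]
      exact fun k => (hy n k).resolve_left (not_not.2 (mem_range_self z))
  rw [this]
  exact .iInter fun n => .iInter fun k =>
    ((hf n).isClosed_range.isOpen_compl.union (hU n k)).isGδ

namespace Hyperspace

open TopologicalSpace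

variable {X : Type*} [CStarAlgebra X]

theorem convexIn_subset_CKPos {S : Set (WeakDual ℂ X)} (hS : IsCompact S)
    (hSp : S ⊆ positiveDual X) : convexIn S ⊆ CKPos X :=
  fun F hF => ⟨⟨hF.1, hS.of_isClosed_subset F.isClosed hF.2⟩, hF.2.trans hSp⟩

theorem isDenseGδIn_convexIn [SeparableSpace X] (hX : ¬ FiniteDimensional ℂ X)
    {S : Set (WeakDual ℂ X)} (hSc : IsCompact S) (hS : Convex ℝ S) (hSp : S ⊆ positiveDual X)
    (hE : stateSpace X ⊆ S) : IsDenseGδIn (DPos X ∩ convexIn S) (convexIn S) := by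
  have h : ((↑) ⁻¹' (DPos X ∩ convexIn S) : Set (convexIn S)) =
      {F | F.1.carrier = closure (F.1.carrier.extremePoints ℝ)} := by
    ext F
    exact ⟨fun h => h.1.2, fun h => ⟨⟨convexIn_subset_CKPos hSc hSp F.2, h⟩, F.2⟩⟩
  rw [IsDenseGδIn, h]
  exact ⟨inter_subset_right, dense_isGδ_closure_extremePoints hSc hS fun T hT =>
    (exists_state_notMem_span hX hT).imp fun φ h => ⟨hE h.1, h.2⟩⟩

theorem positiveBall_subset (r : ℝ) : positiveBall X r ⊆ positiveDual X := fun _ h => h.1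

theorem stateSpace_subset_positiveBall {r : ℝ} (hr : 1 ≤ r) :
    stateSpace X ⊆ positiveBall X r := fun _ h => ⟨h.1, h.2.le.trans hr⟩

theorem CKPosLeOne_eq : CKPosLeOne X = convexIn (positiveBall X 1) := by
  ext F
  exact ⟨fun h => ⟨h.1.1.1, fun σ hσ => ⟨h.1.2 hσ, h.2 σ hσ⟩⟩, fun h =>
    ⟨convexIn_subset_CKPos (isCompact_positiveBall 1) (positiveBall_subset 1) h,
      fun σ hσ => (h.2 hσ).2⟩⟩

theorem CKPosOne_eq : CKPosOne X = convexIn (stateSpace X) := by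
  ext F
  exact ⟨fun h => ⟨h.1.1.1, fun σ hσ => ⟨h.1.2 hσ, h.2 σ hσ⟩⟩, fun h =>
    ⟨convexIn_subset_CKPos isCompact_stateSpace (fun _ h => h.1) h, fun σ hσ => (h.2 hσ).2⟩⟩

theorem mem_convexIn_positiveBall_iff {F : Hyperspace X} (hF : F ∈ CKPos X) {r : ℝ} :
    F ∈ convexIn (positiveBall X r) ↔ (F.values 1 : Set ℂ) ⊆ Metric.closedBall 0 r := by
  rw [values_subset_iff Metric.isClosed_closedBall]
  have h : ∀ σ ∈ F.carrier, σ 1 ∈ Metric.closedBall 0 r ↔ σ ∈ positiveBall X r := fun σ hσ => by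
    rw [mem_closedBall_zero_iff, apply_one_eq_norm (hF.2 hσ), Complex.norm_real, norm_norm]
    exact ⟨fun h => ⟨hF.2 hσ, h⟩, fun h => h.2⟩
  exact ⟨fun hr σ hσ => (h σ hσ).2 (hr.2 hσ), fun hr => ⟨hF.1.1, fun σ hσ => (h σ hσ).1 (hr σ hσ)⟩⟩

theorem exists_nat_mem_convexIn {F : Hyperspace X} (hF : F ∈ CF X)
    (hp : F.carrier ⊆ positiveDual X) (hb : TotallyBounded (F.values 1 : Set ℂ)) :
    ∃ n : ℕ, F ∈ convexIn (positiveBall X (n + 1)) := by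
  obtain ⟨r, hr⟩ := hb.isBounded.subset_closedBall 0
  obtain ⟨n, hn⟩ := exists_nat_ge r
  refine ⟨n, hF, fun σ hσ => ⟨hp hσ, ?_⟩⟩
  have h := hr (apply_mem_values hσ 1)
  rw [mem_closedBall_zero_iff, apply_one_eq_norm (hp hσ), Complex.norm_real, norm_norm] at h
  linarith

theorem totallyBounded_values {F : Hyperspace X} (hF : F ∈ CK X) (A : X) :
    TotallyBounded (F.values A : Set ℂ) :=
  (hF.2.image (WeakDual.eval_continuous A)).totallyBounded.closure

-- Positivity is a closed condition on the values at each `A * star A`. Given positivity, bounded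
-- values at `1` bound the norm, so compactness amounts to total boundedness of those values, which
-- is closed for the Hausdorff distance.
open scoped ComplexOrder in
theorem isClosed_CKPos : IsClosed ((↑) ⁻¹' CKPos X : Set (CF X)) := by
  have h : ((↑) ⁻¹' CKPos X : Set (CF X)) =
      (⋂ A : X, {F | (F.1.values (A * star A) : Set ℂ) ⊆ Ici 0}) ∩
        {F | TotallyBounded (F.1.values 1 : Set ℂ)} := by
    ext F
    simp only [mem_preimage, mem_inter_iff, mem_iInter, mem_ofPred_eq,
      values_subset_iff (isClosed_Ici (a := (0 : ℂ)))]
    constructor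
    · exact fun hF => ⟨fun A σ hσ => hF.2 hσ A, totallyBounded_values hF.1 1⟩
    · rintro ⟨hp, hb⟩
      obtain ⟨n, hn⟩ := exists_nat_mem_convexIn F.2 (fun σ hσ A => hp A σ hσ) hb
      exact convexIn_subset_CKPos (isCompact_positiveBall _) (positiveBall_subset _) hn
  rw [h]
  refine (isClosed_iInter fun A => ?_).inter ?_
  · exact (Closeds.isClosed_subsets_of_isClosed isClosed_Ici).preimage
      ((continuous_values (A * star A)).comp continuous_subtype_val)
  · exact Closeds.isClosed_setOfPred_totallyBounded.preimage
      ((continuous_values 1).comp continuous_subtype_val)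

theorem isClosedEmbedding_inclusion_convexIn (r : ℝ) :
    IsClosedEmbedding (inclusion (convexIn_subset_CKPos (isCompact_positiveBall r)
      (positiveBall_subset (X := X) r))) := by
  refine ⟨IsEmbedding.inclusion _, ?_⟩
  have h : range (inclusion (convexIn_subset_CKPos (isCompact_positiveBall r)
      (positiveBall_subset (X := X) r))) =
      {F | (F.1.values 1 : Set ℂ) ⊆ Metric.closedBall 0 r} := by
    ext F
    rw [range_inclusion]
    exact mem_convexIn_positiveBall_iff F.2
  rw [h]
  exact (Closeds.isClosed_subsets_of_isClosed Metric.isClosed_closedBall).preimage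
    ((continuous_values 1).comp continuous_subtype_val)

theorem isDenseGδIn_CKPos [SeparableSpace X] (hX : ¬ FiniteDimensional ℂ X) :
    IsDenseGδIn (DPos X) (CKPos X) := by
  -- Radius `n + 1` is at least one, so each ball contains all states, as the density argument
  -- requires.
  let f : ∀ n : ℕ, convexIn (positiveBall X (n + 1)) → CKPos X := fun n =>
    inclusion (convexIn_subset_CKPos (isCompact_positiveBall _) (positiveBall_subset _))
  have hcov : ∀ F : CKPos X, ∃ n, F ∈ range (f n) := fun F => by
    obtain ⟨n, hn⟩ := exists_nat_mem_convexIn F.2.1.1 F.2.2 (totallyBounded_values F.2.1 1)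
    exact ⟨n, ⟨F.1, hn⟩, rfl⟩
  have hD : ∀ n : ℕ, Dense (f n ⁻¹' ((↑) ⁻¹' DPos X)) ∧ IsGδ (f n ⁻¹' ((↑) ⁻¹' DPos X)) := by
    intro n
    have h := (isDenseGδIn_convexIn hX (isCompact_positiveBall ((n : ℝ) + 1))
      (convex_positiveBall _) (positiveBall_subset _)
      (stateSpace_subset_positiveBall (by simp))).2
    rw [preimage_inter, Subtype.coe_preimage_self, inter_univ] at h
    exact h
  refine ⟨fun F hF => hF.1, fun F => ?_,
    .of_isClosedEmbedding_cover (fun n => isClosedEmbedding_inclusion_convexIn _) hcov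
      fun n => (hD n).2⟩
  obtain ⟨n, G, rfl⟩ := hcov F
  -- Approximants found inside a ball containing `F` already suffice.
  exact (isClosedEmbedding_inclusion_convexIn _).continuous.closure_preimage_subset _ ((hD n).1 G)

theorem stateSpace_nonempty [Nontrivial X] : (stateSpace X).Nonempty :=
  (exists_state_apply_ne_zero_of_isSelfAdjoint (IsSelfAdjoint.one X) one_ne_zero).imp
    fun _ h => h.1

end Hyperspace

theorem mainTheorem5 (X : Type*) [CStarAlgebra X] [TopologicalSpace.SeparableSpace X]
    (hX : ¬ FiniteDimensional ℂ X) :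
    -- (i)
    (Hyperspace.CKPos X ⊆ Hyperspace.CF X ∧
      IsClosed ((↑) ⁻¹' Hyperspace.CKPos X : Set (Hyperspace.CF X)) ∧
      Hyperspace.IsDenseGδIn (Hyperspace.DPos X) (Hyperspace.CKPos X)) ∧
    -- (ii)
    (CompactSpace (Hyperspace.CKPosLeOne X) ∧
      TopologicalSpace.IsCompletelyMetrizableSpace (Hyperspace.CKPosLeOne X) ∧
      Hyperspace.IsDenseGδIn (Hyperspace.DPos X ∩ Hyperspace.CKPosLeOne X)
        (Hyperspace.CKPosLeOne X)) ∧
    -- (iii)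
    ((∃ E ∈ Hyperspace.CKPosOne X, E.carrier = Hyperspace.stateSpace X) ∧
      CompactSpace (Hyperspace.CKPosOne X) ∧
      TopologicalSpace.IsCompletelyMetrizableSpace (Hyperspace.CKPosOne X) ∧
      Hyperspace.IsDenseGδIn (Hyperspace.DPos X ∩ Hyperspace.CKPosOne X)
        (Hyperspace.CKPosOne X)) := by
  have : Nontrivial X := by
    by_contra h
    have := not_nontrivial_iff_subsingleton.1 h
    exact hX inferInstance
  refine ⟨⟨fun F hF => hF.1.1, Hyperspace.isClosed_CKPos, Hyperspace.isDenseGδIn_CKPos hX⟩, ?_, ?_⟩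
  · rw [Hyperspace.CKPosLeOne_eq]
    exact ⟨Hyperspace.compactSpace_convexIn (Hyperspace.isCompact_positiveBall 1),
      Hyperspace.isCompletelyMetrizableSpace_convexIn (Hyperspace.isCompact_positiveBall 1),
      Hyperspace.isDenseGδIn_convexIn hX (Hyperspace.isCompact_positiveBall 1)
        (Hyperspace.convex_positiveBall 1) (Hyperspace.positiveBall_subset 1)
        (Hyperspace.stateSpace_subset_positiveBall le_rfl)⟩
  · rw [Hyperspace.CKPosOne_eq]
    exact ⟨⟨⟨Hyperspace.stateSpace X, Hyperspace.stateSpace_nonempty,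
        Hyperspace.isCompact_stateSpace.isClosed⟩,
        ⟨Hyperspace.convex_stateSpace, Subset.rfl⟩, rfl⟩,
      Hyperspace.compactSpace_convexIn Hyperspace.isCompact_stateSpace,
      Hyperspace.isCompletelyMetrizableSpace_convexIn Hyperspace.isCompact_stateSpace,
      Hyperspace.isDenseGδIn_convexIn hX Hyperspace.isCompact_stateSpace
        Hyperspace.convex_stateSpace (fun _ h => h.1) Subset.rfl⟩
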